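/- Let $\mathsf G$ be a finite quiver with vertex set $\{1,\dots,p\}$, finite edge set $\mathsf E$, source and target maps $s,t:\mathsf E\to\{1,\dots,p\}$, and no self-loops ($s(e)\neq t(e)$ for every $e\in\mathsf E$; multiple edges are allowed). Let $n_1,\dots,n_p\geq 1$ be integers and $n=n_1+\cdots+n_p$. To each edge $e$ attach a weight $x_e\in\mathbb C$ and a complex matrix $U_e$ of size $n_{s(e)}\times n_{t(e)}$. Let $\Delta$ be the endomorphism of $\bigoplus_{a=1}^p\mathbb C^{n_a}$ given by $$(\Delta f)(a)=\sum_{e\in\mathsf E:\ s(e)=a}x_e\big(f(a)-U_e f(t(e))\big),\qquad 1\le a\le p .$$ Split $\{1,\dots,n\}$ into consecutive blocks $I_1,\dots,I_p$ with $|I_a|=n_a$, and let $\mathrm{bl}(i)$ be the index of the block containing $i$. Let $\Xi$ be the set of maps $\xi:\{1,\dots,n\}\to\mathsf E$ with $s(\xi(i))=\mathrm{bl}(i)$ for all $i$ (edge stacks), and put $\underline x^{\xi}=\prod_{i=1}^n x_{\xi(i)}$. For $\xi\in\Xi$, let $\Sigma(\xi)$ be the set of permutations $\sigma$ of $\{1,\dots,n\}$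 such that, for every $i$, $\sigma(i)=i$ or $t(\xi(i))=\mathrm{bl}(\sigma(i))$ (well-chained permutations). For $\sigma\in\Sigma(\xi)$, let $C(\sigma)$ be the set of cycles of $\sigma$ of length at least $2$, let $v_a(\sigma)$ be the number of elements of $I_a$ that belong to some cycle in $C(\sigma)$, and for $c=(i_1\,\cdots\,i_r)\in C(\sigma)$, with $i_{k+1}=\sigma(i_k)$, put $$\operatorname{Tr}\operatorname{hol}(c)=\operatorname{Tr}\big(U_{\xi(i_1)}U_{\xi(i_2)}\cdots U_{\xi(i_r)}\big),$$ which does not depend on the choice of the starting point $i_1$ of the cycle. Then $$\det\Delta=\frac{1}{n_1!\cdots n_p!}\sum_{\xi\in\Xi}\underline x^{\xi}\left[\sum_{\sigma\in\Sigma(\xi)}\ \prod_{a=1}^p\big(n_a-v_a(\sigma)\big)!\ \prod_{c\in C(\sigma)}\big(-\operatorname{Tr}\operatorname{hol}(c)\big)\right].$$ -/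

import Mathlib

open Equiv

/-- The twisted Laplacian on `∏ v, ℂ ^ (n v)` of a representation `U` of a finite quiver with edge
weights `x`: `(Δ f) v = ∑ x_e (f v - U_e (f (t e)))`, summed over the edges `e` with source `v`.
An element of `Quiver.Star v` is a pair `⟨t e, e⟩`. -/
def quiverLaplacian {V : Type*} [Quiver V] [Fintype V] [∀ a b : V, Fintype (a ⟶ b)]
    (n : V → ℕ) (x : ∀ {a b : V}, (a ⟶ b) → ℂ)
    (U : ∀ {a b : V}, (a ⟶ b) → Matrix (Fin (n a)) (Fin (n b)) ℂ) :
    (∀ v : V, Fin (n v) → ℂ) →ₗ[ℂ] (∀ v : V, Fin (n v) → ℂ) where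
  toFun f v := ∑ e : Quiver.Star v, x e.2 • (f v - (U e.2).mulVec (f e.1))
  map_add' f g := by
    funext v
    simp only [Pi.add_apply, Matrix.mulVec_add, ← Finset.sum_add_distrib, ← smul_add]
    refine Finset.sum_congr rfl fun e _ => ?_
    congr 1
    abel
  map_smul' c f := by
    funext v
    simp only [Pi.smul_apply, Matrix.mulVec_smul, ← smul_sub, Finset.smul_sum, RingHom.id_apply]
    refine Finset.sum_congr rfl fun e _ => ?_
    rw [smul_comm]

/-- The holonomy `U_{e₁} ⋯ U_{e_k}` along a path `e₁, …, e_k` of a quiver. -/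
def pathHol {V : Type*} [Quiver V] (n : V → ℕ)
    (U : ∀ {a b : V}, (a ⟶ b) → Matrix (Fin (n a)) (Fin (n b)) ℂ) {a : V} :
    ∀ {b : V}, Quiver.Path a b → Matrix (Fin (n a)) (Fin (n b)) ℂ
  | _, Quiver.Path.nil => 1
  | _, Quiver.Path.cons p e => pathHol n U p * U e

/-- The set of `∑ v, n v` indices, divided into blocks: `⟨a, k⟩` is the `k`-th index of the block
of the vertex `a`, and `Sigma.fst` maps an index to its block. -/
abbrev BlockIndex {V : Type*} (n : V → ℕ) : Type _ := Σ a : V, Fin (n a)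

/-- Ordered stacks of edges: for every index `i`, an edge whose source is the block of `i`. -/
abbrev EdgeStack {V : Type*} [Quiver V] (n : V → ℕ) : Type _ :=
  ∀ i : BlockIndex n, Quiver.Star i.1

/-- A permutation `σ` of the indices is well-chained for `ξ` if, for every index `i`, either
`σ i = i` or the edge `ξ i` ends at the block of `σ i`. -/
def WellChained {V : Type*} [Quiver V] {n : V → ℕ} (ξ : EdgeStack n)
    (σ : Perm (BlockIndex n)) : Prop :=
  ∀ i, σ i = i ∨ (ξ i).1 = (σ i).1

instance WellChained.decidablePred {V : Type*} [Quiver V] [Fintype V] [DecidableEq V] {n : V → ℕ} (ξ : EdgeStack n) :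
    DecidablePred (WellChained ξ) :=
  fun σ => inferInstanceAs (Decidable (∀ i, σ i = i ∨ (ξ i).1 = (σ i).1))

/-- The path of the quiver that starts at the block of a non-fixed index `i` of `σ` and follows the
`k` edges `ξ i, ξ (σ i), …, ξ (σ^(k-1) i)`. -/
def WellChained.walk {V : Type*} [Quiver V] {n : V → ℕ} {ξ : EdgeStack n}
    {σ : Perm (BlockIndex n)} (h : WellChained ξ σ) :
    ∀ (k : ℕ) (i : BlockIndex n), σ i ≠ i → Quiver.Path i.1 (σ^[k] i).1
  | 0, _, _ => Quiver.Path.nil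
  | k + 1, i, hi =>
      (((ξ i).2.cast rfl ((h i).resolve_left hi)).toPath).comp
        (h.walk k (σ i) fun h' => hi (σ.injective h'))

/-- The closed path of the quiver traced by the cycle of `σ` through a non-fixed index `i`, started
at `i`; its length is that of the cycle. -/
noncomputable def WellChained.loop {V : Type*} [Quiver V] {n : V → ℕ} {ξ : EdgeStack n}
    {σ : Perm (BlockIndex n)} (h : WellChained ξ σ) (i : BlockIndex n) (hi : σ i ≠ i) :
    Quiver.Path i.1 i.1 :=
  (h.walk (Function.minimalPeriod σ i) i hi).cast rfl
    (congrArg Sigma.fst (Function.iterate_minimalPeriod (f := σ) (x := i)))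

theorem exists_base {α : Type*} [Fintype α] [DecidableEq α] {σ : Perm α}
    (c : {c : Perm α // c ∈ σ.cycleFactorsFinset}) : ∃ i, i ∈ c.1.support := by
  have hc := (Perm.mem_cycleFactorsFinset_iff.1 c.2).1
  obtain ⟨i, hi, -⟩ := hc
  exact ⟨i, Perm.mem_support.2 hi⟩

theorem apply_ne_of_mem {α : Type*} [Fintype α] [DecidableEq α] {σ : Perm α}
    (c : {c : Perm α // c ∈ σ.cycleFactorsFinset}) {i : α} (hi : i ∈ c.1.support) : σ i ≠ i := by
  rw [← (Perm.mem_cycleFactorsFinset_iff.1 c.2).2 i hi]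
  exact Perm.mem_support.1 hi

/-- `Tr hol(c)` for a cycle `c` of length at least two of a well-chained permutation `σ`: the trace
of the holonomy along the cycle of the quiver traced by `c`, started at an arbitrary index of `c`
(the trace does not depend on it, see `WellChained.traceHol_eq`). -/
noncomputable def WellChained.traceHol {V : Type*} [Quiver V] [Fintype V] [DecidableEq V]
    {n : V → ℕ} (U : ∀ {a b : V}, (a ⟶ b) → Matrix (Fin (n a)) (Fin (n b)) ℂ)
    {ξ : EdgeStack n} {σ : Perm (BlockIndex n)} (h : WellChained ξ σ)
    (c : {c : Perm (BlockIndex n) // c ∈ σ.cycleFactorsFinset}) : ℂ :=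
  Matrix.trace (pathHol n U
    (h.loop (exists_base c).choose (apply_ne_of_mem c (exists_base c).choose_spec)))

theorem pathHol_comp {V : Type*} [Quiver V] (n : V → ℕ)
    (U : ∀ {a b : V}, (a ⟶ b) → Matrix (Fin (n a)) (Fin (n b)) ℂ) {a b c : V}
    (p : Quiver.Path a b) (q : Quiver.Path b c) :
    pathHol n U (p.comp q) = pathHol n U p * pathHol n U q := by
  induction q with
  | nil => simp [pathHol]
  | cons q e ih => simp [pathHol, ih, Matrix.mul_assoc]

theorem path_comp_cast {V : Type*} [Quiver V] {a b c c' : V} (p : Quiver.Path a b)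
    (q : Quiver.Path b c) (h : c = c') : p.comp (q.cast rfl h) = (p.comp q).cast rfl h := by
  subst h
  rfl

theorem WellChained.walk_succ' {V : Type*} [Quiver V] {n : V → ℕ} {ξ : EdgeStack n}
    {σ : Perm (BlockIndex n)} (h : WellChained ξ σ) :
    ∀ (k : ℕ) (i : BlockIndex n) (hi : σ i ≠ i) (hk : σ (σ^[k] i) ≠ σ^[k] i),
      h.walk (k + 1) i hi = (h.walk k i hi).comp
        ((ξ (σ^[k] i)).2.cast rfl (((h (σ^[k] i)).resolve_left hk).trans
          (congrArg Sigma.fst (Function.iterate_succ_apply' σ k i).symm))).toPath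
  | 0, i, hi, hk => by
      rfl
  | k + 1, i, hi, hk => by
      have ih := h.walk_succ' k (σ i) (fun h' => hi (σ.injective h')) hk
      exact (congrArg (Quiver.Path.comp _) ih).trans (Quiver.Path.comp_assoc _ _ _).symm

theorem trace_pathHol_rotate {V : Type*} [Quiver V] (n : V → ℕ)
    (U : ∀ {a b : V}, (a ⟶ b) → Matrix (Fin (n a)) (Fin (n b)) ℂ) {ξ : EdgeStack n}
    {i j : BlockIndex n} (hj : j = i) {b : V} (p : Quiver.Path b j.1) (hi : (ξ i).1 = b)
    {b' : V} (hj' : (ξ j).1 = b') (hb : b' = b) :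
    (pathHol n U ((((ξ i).2.cast rfl hi).toPath.comp p).cast rfl
      (congrArg Sigma.fst hj))).trace =
    (pathHol n U ((p.comp ((ξ j).2.cast rfl hj').toPath).cast rfl hb)).trace := by
  subst hj hb hj'
  simp only [Quiver.Path.cast_rfl_rfl, Quiver.Hom.cast_rfl_rfl, pathHol_comp]
  exact Matrix.trace_mul_comm _ _

theorem WellChained.trace_walk_apply {V : Type*} [Quiver V]
    {n : V → ℕ} (U : ∀ {a b : V}, (a ⟶ b) → Matrix (Fin (n a)) (Fin (n b)) ℂ)
    {ξ : EdgeStack n} {σ : Perm (BlockIndex n)} (h : WellChained ξ σ)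
    (i : BlockIndex n) (hi : σ i ≠ i) (hi' : σ (σ i) ≠ σ i) (r r' : ℕ) (hr : 0 < r) (hrr : r' = r)
    (h1 : σ^[r] i = i) (h2 : σ^[r'] (σ i) = σ i) :
    (pathHol n U ((h.walk r' (σ i) hi').cast rfl (congrArg Sigma.fst h2))).trace =
      (pathHol n U ((h.walk r i hi).cast rfl (congrArg Sigma.fst h1))).trace := by
  subst hrr
  obtain ⟨m, rfl⟩ : ∃ m, r' = m + 1 := ⟨r' - 1, by omega⟩
  have h3 : σ^[m] (σ i) = i := h1
  have hk : σ (σ^[m] (σ i)) ≠ σ^[m] (σ i) := by rwa [h3]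
  rw [h.walk_succ' m (σ i) hi' hk]
  exact (trace_pathHol_rotate n U h3 (h.walk m (σ i) hi') ((h i).resolve_left hi) _ _).symm

theorem WellChained.trace_loop_apply {V : Type*} [Quiver V] [Fintype V]
    {n : V → ℕ} (U : ∀ {a b : V}, (a ⟶ b) → Matrix (Fin (n a)) (Fin (n b)) ℂ)
    {ξ : EdgeStack n} {σ : Perm (BlockIndex n)} (h : WellChained ξ σ)
    (i : BlockIndex n) (hi : σ i ≠ i) (hi' : σ (σ i) ≠ σ i) :
    (pathHol n U (h.loop (σ i) hi')).trace = (pathHol n U (h.loop i hi)).trace := by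
  have hi0 : i ∈ Function.periodicPts σ := σ.injective.mem_periodicPts i
  exact h.trace_walk_apply U i hi hi' _ _ (Function.minimalPeriod_pos_of_mem_periodicPts hi0)
    (Function.minimalPeriod_apply hi0) Function.iterate_minimalPeriod
    Function.iterate_minimalPeriod

/-- The trace of the holonomy along a cycle does not depend on the index where it is started. -/
theorem WellChained.traceHol_eq {V : Type*} [Quiver V] [Fintype V] [DecidableEq V]
    {n : V → ℕ} (U : ∀ {a b : V}, (a ⟶ b) → Matrix (Fin (n a)) (Fin (n b)) ℂ)
    {ξ : EdgeStack n} {σ : Perm (BlockIndex n)} (h : WellChained ξ σ)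
    (c : {c : Perm (BlockIndex n) // c ∈ σ.cycleFactorsFinset}) (i : BlockIndex n)
    (hi : i ∈ c.1.support) :
    h.traceHol U c = (pathHol n U (h.loop i (apply_ne_of_mem c hi))).trace := by
  have key : ∀ (k : ℕ) (j : BlockIndex n) (hj : σ j ≠ j) (j' : BlockIndex n) (hj' : σ j' ≠ j'),
      (σ ^ k) j = j' →
      (pathHol n U (h.loop j hj)).trace = (pathHol n U (h.loop j' hj')).trace := by
    intro k
    induction k with
    | zero =>
      intro j hj j' hj' e
      obtain rfl : j = j' := e
      rfl
    | succ k ih =>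
      intro j hj j' hj' e
      rw [← h.trace_loop_apply U j hj fun e' => hj (σ.injective e')]
      exact ih _ _ _ _ (by rw [← e, pow_succ, Perm.mul_apply])
  have hs : σ.SameCycle (exists_base c).choose i := by
    have hc := Perm.mem_cycleFactorsFinset_iff.1 c.2
    have hb := (exists_base c).choose_spec
    have h1 := Perm.cycle_is_cycleOf hb c.2
    have h2 := Perm.cycle_is_cycleOf hi c.2
    have h3 : i ∈ (σ.cycleOf (exists_base c).choose).support := h1 ▸ hi
    exact (Perm.mem_support_cycleOf_iff.1 h3).1
  obtain ⟨k, -, hk⟩ := hs.exists_pow_eq'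
  exact key k _ _ _ _ hk

/-- `v_a(c)`, the number of visits of a cycle `c` of a permutation of the indices to the vertex
`a`: the number of indices of the cycle that lie in the block of `a`. -/
def cycleVisits {V : Type*} [Fintype V] [DecidableEq V] {n : V → ℕ} (a : V)
    (c : Perm (BlockIndex n)) : ℕ :=
  (c.support.filter fun i => i.1 = a).card

/-- `v_a(σ)`, the total number of visits to the vertex `a` of the cycles of `σ` of length at least
two. -/
def visits {V : Type*} [Fintype V] [DecidableEq V] {n : V → ℕ} (a : V)
    (σ : Perm (BlockIndex n)) : ℕ :=
  ∑ c ∈ σ.cycleFactorsFinset, cycleVisits a c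

theorem visits_eq {V : Type*} [Fintype V] [DecidableEq V] {n : V → ℕ} (a : V)
    (σ : Perm (BlockIndex n)) : visits a σ = (σ.support.filter fun i => i.1 = a).card := by
  classical
  have h1 : σ.support = σ.cycleFactorsFinset.biUnion Perm.support := by
    ext i
    simp only [Finset.mem_biUnion]
    constructor
    · intro hi
      exact ⟨σ.cycleOf i, Perm.cycleOf_mem_cycleFactorsFinset_iff.2 hi,
        Perm.mem_support_cycleOf_iff.2 ⟨Perm.SameCycle.refl _ _, hi⟩⟩
    · rintro ⟨c, hc, hi⟩
      exact Perm.mem_cycleFactorsFinset_support_le hc hi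
  rw [h1, Finset.filter_biUnion, Finset.card_biUnion]
  · rfl
  · intro c hc d hd hcd
    exact Finset.disjoint_filter_filter
      ((Perm.cycleFactorsFinset_pairwise_disjoint σ hc hd hcd).disjoint_support)

/-- The subtraction in `n a - visits a σ` does not truncate. -/
theorem visits_le {V : Type*} [Fintype V] [DecidableEq V] {n : V → ℕ} (a : V)
    (σ : Perm (BlockIndex n)) : visits a σ ≤ n a := by
  rw [visits_eq]
  have h := Finset.card_le_card_of_injOn (s := σ.support.filter fun i => i.1 = a)
    (t := (Finset.univ : Finset (Fin (n a))).map ⟨Sigma.mk a, sigma_mk_injective⟩) id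
    (fun i hi => by
      obtain ⟨b, k⟩ := i
      obtain rfl : b = a := (Finset.mem_filter.1 hi).2
      simp) (Function.injective_id.injOn)
  simpa using h

/-! Average over the relabellings `g` permuting indices inside each block. Conjugation by `g` leaves
the determinant unchanged, and row multilinearity expands each of the `∏ n_a!` copies over edge
stacks `ξ` (`det_laplacianMatrix_relabel`). It remains to compare, for each `ξ`, the sum over `g` of
the determinants with the sum over well-chained permutations (`sum_det_relabel`).

With no self-loops the edge blocks have zero diagonal, so each determinant is a sum over `σ` of
signed weights that depend on `g` only through its restriction `f` to the support of `σ`. A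
block-preserving injection `f` extends to exactly `∏ (n_a - v_a)!` relabellings. On the other side,
the product of the `-Tr hol(c)` expands into the same weights, but summed over all maps `f` on the
support (`WellChained.prod_traceHol`).

The extra maps do not matter. If `f` leaves a block, each weight vanishes. If `f` is not injective,
its weights cancel once summed over all `σ` of a given support, by a determinant with two equal
columns (`sum_permWeight_eq_zero`); this is legitimate because the factorials depend only on the
support. -/

/-! ### Factoring sums over maps on disjoint sets -/

/-- The self-maps of `α` that are the identity outside `S`. -/
def mapsOn {α : Type*} [Fintype α] [DecidableEq α] (S : Finset α) : Finset (α → α) :=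
  Finset.univ.filter fun h => ∀ i, i ∉ S → h i = i

theorem mem_mapsOn {α : Type*} [Fintype α] [DecidableEq α] {S : Finset α} {h : α → α} :
    h ∈ mapsOn S ↔ ∀ i, i ∉ S → h i = i := by
  simp [mapsOn]

theorem sum_mapsOn_union {α R : Type*} [Fintype α] [DecidableEq α] [CommSemiring R]
    {A B : Finset α} (hAB : Disjoint A B) (f g : (α → α) → R)
    (hf : ∀ h h', (∀ i ∈ A, h i = h' i) → f h = f h')
    (hg : ∀ h h', (∀ i ∈ B, h i = h' i) → g h = g h') :
    ∑ h ∈ mapsOn (A ∪ B), f h * g h = (∑ h ∈ mapsOn A, f h) * ∑ h ∈ mapsOn B, g h := by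
  rw [Finset.sum_mul_sum, ← Finset.sum_product']
  have hB : ∀ i ∈ B, i ∉ A := fun i hi hA => Finset.disjoint_left.1 hAB hA hi
  refine Finset.sum_nbij' (fun h => (A.piecewise h id, B.piecewise h id))
    (fun u => A.piecewise u.1 u.2) ?_ ?_ ?_ ?_ ?_
  · intro h _
    simp only [Finset.mem_product, mem_mapsOn]
    exact ⟨fun i hi => by simp [hi], fun i hi => by simp [hi]⟩
  · intro u hu
    simp only [Finset.mem_product, mem_mapsOn] at hu ⊢
    intro i hi
    rw [Finset.mem_union, not_or] at hi
    simp [hi.1, hu.2 i hi.2]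
  · intro h hh
    rw [mem_mapsOn] at hh
    funext i
    by_cases hA : i ∈ A
    · simp [hA]
    by_cases hB : i ∈ B
    · simp [hA, hB]
    · simp [hA, hB, hh i (by simp [hA, hB])]
  · intro u hu
    simp only [Finset.mem_product, mem_mapsOn] at hu
    ext i
    · by_cases hA : i ∈ A
      · simp [hA]
      · simp [hA, hu.1 i hA]
    · by_cases hi : i ∈ B
      · simp [hi, hB i hi]
      · simp [hi, hu.2 i hi]
  · intro h _
    exact congrArg₂ _ (hf _ _ fun i hi => by simp [hi]) (hg _ _ fun i hi => by simp [hi])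

theorem sum_mapsOn_biUnion {ι α R : Type*} [DecidableEq ι] [Fintype α] [DecidableEq α]
    [CommSemiring R] (T : Finset ι) (s : ι → Finset α)
    (hs : (T : Set ι).PairwiseDisjoint s) (f : ι → (α → α) → R)
    (hf : ∀ c ∈ T, ∀ h h', (∀ i ∈ s c, h i = h' i) → f c h = f c h') :
    ∑ h ∈ mapsOn (T.biUnion s), ∏ c ∈ T, f c h = ∏ c ∈ T, ∑ h ∈ mapsOn (s c), f c h := by
  induction T using Finset.induction_on with
  | empty =>
    have : mapsOn (∅ : Finset α) = {id} := by
      ext h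
      simp [mem_mapsOn, funext_iff]
    simp [this]
  | insert c T hc ih =>
    rw [Finset.prod_insert hc, ← ih (hs.subset (by simp))
      fun d hd => hf d (Finset.mem_insert_of_mem hd), Finset.biUnion_insert,
      ← sum_mapsOn_union _ _ _ (hf c (Finset.mem_insert_self _ _))]
    · exact Finset.sum_congr rfl fun h _ => Finset.prod_insert hc
    · intro h h' hh
      refine Finset.prod_congr rfl fun d hd => hf d (Finset.mem_insert_of_mem hd) _ _ fun i hi =>
        hh i (Finset.mem_biUnion.2 ⟨d, hd, hi⟩)
    · rw [Finset.disjoint_biUnion_right]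
      intro d hd
      exact hs (by simp) (by simp [hd]) (by rintro rfl; exact hc hd)

/-! ### Traces of cyclic products as sums over maps -/

/-- The product `N i * N (σ i) * ⋯ * N (σ^(k-1) i)`. -/
def orbitProd {α β R : Type*} [Fintype β] [DecidableEq β] [Semiring R]
    (N : α → Matrix β β R) (σ : α → α) : ℕ → α → Matrix β β R
  | 0, _ => 1
  | k + 1, i => N i * orbitProd N σ k (σ i)

theorem sum_fin_orbitProd {α β R : Type*} [Fintype β] [DecidableEq β] [CommRing R]
    (N : α → Matrix β β R) (σ : α → α) (k : ℕ) (i : α) (φ : β → β → R) :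
    ∑ u : Fin (k + 1) → β,
      (∏ m : Fin k, N (σ^[m] i) (u m.castSucc) (u m.succ)) * φ (u 0) (u (Fin.last k)) =
    ∑ a, ∑ b, orbitProd N σ k i a b * φ a b := by
  induction k generalizing i φ with
  | zero =>
    rw [← (Equiv.funUnique (Fin 1) β).symm.sum_comp]
    simp [orbitProd, Matrix.one_apply]
  | succ k ih =>
    rw [← (Fin.consEquiv fun _ : Fin (k + 2) => β).sum_comp, Fintype.sum_prod_type,
      Finset.sum_comm]
    -- The arbitrary test function `φ` lets the induction absorb the first factor `N i` and the sum
    -- over its row index.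
    have h := ih (σ i) fun a' b => ∑ a, N i a a' * φ a b
    simp only [Fin.consEquiv_apply, Fin.prod_univ_succ, Fin.castSucc_zero, Fin.cons_zero,
      Fin.cons_succ, Fin.val_zero, Function.iterate_zero, id, ← Fin.succ_castSucc, Fin.val_succ,
      Function.iterate_succ, Function.comp, ← Fin.succ_last]
    have h' : ∀ u : Fin (k + 1) → β,
        ∑ a, N i a (u 0) * (∏ m : Fin k, N (σ^[m] (σ i)) (u m.castSucc) (u m.succ)) *
          φ a (u (Fin.last k)) =
        (∏ m : Fin k, N (σ^[m] (σ i)) (u m.castSucc) (u m.succ)) *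
          ∑ a, N i a (u 0) * φ a (u (Fin.last k)) := by
      intro u
      rw [Finset.mul_sum]
      exact Finset.sum_congr rfl fun a _ => by ring
    refine (Finset.sum_congr rfl fun u _ => h' u).trans (h.trans ?_)
    simp only [orbitProd, Matrix.mul_apply, Finset.mul_sum, Finset.sum_mul]
    rw [Finset.sum_comm]
    rw [Finset.sum_congr rfl fun b _ => Finset.sum_comm]
    rw [Finset.sum_comm]
    refine Finset.sum_congr rfl fun a _ => Finset.sum_congr rfl fun b _ =>
      Finset.sum_congr rfl fun c _ => by ring

/-- Expanding the trace attaches one free matrix index to each point of the orbit, which is a map on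
`S`. The map need not be injective. -/
theorem sum_mapsOn_eq_trace {α R : Type*} [Fintype α] [DecidableEq α] [CommRing R]
    (N : α → Matrix α α R) (σ : α → α) (k : ℕ) (i : α) (S : Finset α)
    (hinj : Set.InjOn (fun m => σ^[m] i) (Set.Iio (k + 1)))
    (hS : S = (Finset.range (k + 1)).image fun m => σ^[m] i) (hk : σ^[k + 1] i = i) :
    ∑ h ∈ mapsOn S, ∏ j ∈ S, N j (h j) (h (σ j)) = (orbitProd N σ (k + 1) i).trace := by
  have hrw : ∀ h : α → α, ∏ j ∈ S, N j (h j) (h (σ j)) =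
      (∏ m : Fin k, N (σ^[m] i) (h (σ^[m] i)) (h (σ^[m + 1] i))) *
        N (σ^[k] i) (h (σ^[k] i)) (h i) := by
    intro h
    rw [hS, Finset.prod_image (by simpa using hinj), Finset.prod_range_succ,
      Finset.prod_range]
    simp only [← Function.iterate_succ_apply' σ, hk]
  have hmem : ∀ m : Fin (k + 1), σ^[m] i ∈ S := fun m => by
    rw [hS]
    exact Finset.mem_image.2 ⟨m, Finset.mem_range.2 m.2, rfl⟩
  have hbij : Function.Bijective fun m : Fin (k + 1) => (⟨σ^[m] i, hmem m⟩ : S) := by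
    constructor
    · intro m m' h
      exact Fin.ext (hinj m.2 m'.2 (congrArg Subtype.val h))
    · rintro ⟨j, hj⟩
      rw [hS, Finset.mem_image] at hj
      obtain ⟨m, hm, rfl⟩ := hj
      exact ⟨⟨m, Finset.mem_range.1 hm⟩, rfl⟩
  let e : Fin (k + 1) ≃ S := Equiv.ofBijective _ hbij
  have he : ∀ m : Fin (k + 1), (e m : α) = σ^[m] i := fun _ => rfl
  have hsum : ∑ h ∈ mapsOn S, ∏ j ∈ S, N j (h j) (h (σ j)) =
      ∑ u : Fin (k + 1) → α,
        (∏ m : Fin k, N (σ^[m] i) (u m.castSucc) (u m.succ)) *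
          N (σ^[k] i) (u (Fin.last k)) (u 0) := by
    refine Finset.sum_nbij' (fun h m => h (e m))
      (fun u j => if hj : j ∈ S then u (e.symm ⟨j, hj⟩) else j) ?_ ?_ ?_ ?_ ?_
    · simp
    · intro u _
      rw [mem_mapsOn]
      intro j hj
      simp [hj]
    · intro h hh
      rw [mem_mapsOn] at hh
      funext j
      by_cases hj : j ∈ S
      · simp [hj]
      · simp [hj, hh j hj]
    · intro u _
      funext m
      simp
    · intro h _
      rw [hrw]
      simp [he]
  rw [hsum, sum_fin_orbitProd N σ k i fun a b => N (σ^[k] i) b a]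
  have hsucc : ∀ (k : ℕ) (i : α), orbitProd N σ (k + 1) i = orbitProd N σ k i * N (σ^[k] i) := by
    intro k
    induction k with
    | zero => intro i; simp [orbitProd]
    | succ k ih =>
      intro i
      rw [orbitProd, ih, ← Matrix.mul_assoc]
      rfl
  rw [hsucc, Matrix.trace]
  simp only [Matrix.diag_apply, Matrix.mul_apply]

/-- Extend `φ` to a permutation `τ₀`. Left translation by `τ₀⁻¹` turns the condition into fixing `T`
pointwise, which leaves the permutations of the complement. -/
theorem card_perm_eqOn {β : Type*} [Fintype β] [DecidableEq β] (T : Finset β) (φ : β → β)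
    (hφ : Set.InjOn φ T) :
    (Finset.univ.filter fun τ : Perm β => ∀ k ∈ T, τ k = φ k).card =
      (Fintype.card β - T.card).factorial := by
  obtain ⟨g, hg⟩ := Finset.exists_equiv_extend_of_card_eq (t := (Finset.univ : Finset β)) rfl
    (Finset.subset_univ (T.image φ)) hφ
  let τ₀ : Perm β := g.trans (Equiv.subtypeUnivEquiv Finset.mem_univ)
  have hτ₀ : ∀ k ∈ T, τ₀ k = φ k := hg
  have h1 : (Finset.univ.filter fun τ : Perm β => ∀ k ∈ T, τ k = φ k).card =
      (Finset.univ.filter fun τ : Perm β => ∀ k, ¬ k ∉ T → τ k = k).card := by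
    refine Finset.card_nbij' (fun τ => τ₀⁻¹ * τ) (fun τ => τ₀ * τ) ?_ ?_ ?_ ?_
    · intro τ hτ
      simp only [Finset.coe_filter, Finset.mem_univ, true_and, Set.mem_ofPred_eq, not_not] at hτ ⊢
      intro k hk
      rw [Perm.mul_apply, hτ k hk, ← hτ₀ k hk]
      exact τ₀.symm_apply_apply k
    · intro τ hτ
      simp only [Finset.coe_filter, Finset.mem_univ, true_and, Set.mem_ofPred_eq, not_not] at hτ ⊢
      intro k hk
      rw [Perm.mul_apply, hτ k hk, hτ₀ k hk]
    · intro τ _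
      simp
    · intro τ _
      simp
  rw [h1, ← Fintype.card_subtype,
    ← Fintype.card_congr (Perm.subtypeEquivSubtypePerm fun k => k ∉ T), Fintype.card_perm]
  congr 1
  rw [Fintype.card_subtype_compl]
  simp

/-! ### Signed weights and their cancellation -/

/-- The signed weight of a permutation of which each non-fixed index `i` contributes
`-N i (h i) (h (σ i))`. -/
def permWeight {α R : Type*} [Fintype α] [DecidableEq α] [CommRing R]
    (N : α → Matrix α α R) (h : α → α) (σ : Perm α) : R :=
  ((Perm.sign σ : ℤ) : R) * ∏ i ∈ σ.support, -N i (h i) (h (σ i))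

theorem det_one_sub_eq_sum_permWeight {α R : Type*} [Fintype α] [DecidableEq α] [CommRing R]
    (N : α → Matrix α α R) (h : α → α) (hN : ∀ i, N i (h i) (h i) = 0) :
    (Matrix.of fun i j => (1 : Matrix α α R) i j - N i (h i) (h j)).det =
      ∑ σ, permWeight N h σ := by
  rw [← Matrix.det_transpose, Matrix.det_apply']
  refine Finset.sum_congr rfl fun σ _ => ?_
  rw [permWeight]
  congr 1
  rw [← Finset.prod_subset (Finset.subset_univ σ.support)]
  · refine Finset.prod_congr rfl fun i hi => ?_
    have := (Perm.mem_support.1 hi).symm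
    simp [this]
  · intro i _ hi
    rw [Perm.notMem_support] at hi
    simp [hi, hN]

/-- If `h` takes the same value at two indices of `S`, the weights of the permutations with
support `S` cancel: they are the terms of a determinant with two equal columns. -/
theorem sum_permWeight_eq_zero {α R : Type*} [Fintype α] [DecidableEq α] [CommRing R]
    (N : α → Matrix α α R) (h : α → α) (hN : ∀ i, N i (h i) (h i) = 0) (S : Finset α)
    {i j : α} (hi : i ∈ S) (hj : j ∈ S) (hij : i ≠ j) (hh : h i = h j) :
    ∑ σ : Perm α with σ.support = S, permWeight N h σ = 0 := by
  -- Identity rows outside `S` force points there to be fixed, and the zero diagonal on `S` forces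
  -- points of `S` to move, so only permutations of support exactly `S` survive in `A.det`.
  let A : Matrix α α R := Matrix.of fun r s =>
    if r ∈ S then -N r (h r) (h s) else (1 : Matrix α α R) r s
  have hA : A.det = 0 := by
    refine Matrix.det_zero_of_column_eq hij fun r => ?_
    by_cases hr : r ∈ S
    · simp [A, hr, hh]
    · have h1 : r ≠ i := fun e => hr (e ▸ hi)
      have h2 : r ≠ j := fun e => hr (e ▸ hj)
      simp [A, hr, h1, h2]
  rw [← hA, ← Matrix.det_transpose, Matrix.det_apply', Finset.sum_filter]
  refine Finset.sum_congr rfl fun σ _ => ?_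
  split_ifs with hσ
  · rw [permWeight]
    congr 1
    rw [← Finset.prod_subset (Finset.subset_univ σ.support)]
    · refine Finset.prod_congr rfl fun r hr => ?_
      rw [hσ] at hr
      simp [A, hr]
    · intro r _ hr
      have := Perm.notMem_support.1 hr
      rw [hσ] at hr
      simp [A, hr, this]
  · symm
    obtain ⟨r, hr⟩ : ∃ r, ¬(r ∈ σ.support ↔ r ∈ S) := by
      by_contra! hc
      exact hσ (Finset.ext hc)
    rw [Finset.prod_eq_zero (Finset.mem_univ r), mul_zero]
    by_cases hrS : r ∈ S
    · have : σ r = r := by simpa [hrS] using hr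
      simp [A, hrS, this, hN]
    · have : r ≠ σ r := fun e => hr (by simp [hrS, ← e])
      simp [A, hrS, this]

theorem support_eq_biUnion_cycleFactorsFinset {α : Type*} [Fintype α] [DecidableEq α]
    (σ : Perm α) : σ.cycleFactorsFinset.biUnion Perm.support = σ.support := by
  ext i
  simp only [Finset.mem_biUnion]
  constructor
  · rintro ⟨c, hc, hi⟩
    exact Perm.mem_cycleFactorsFinset_support_le hc hi
  · intro hi
    exact ⟨σ.cycleOf i, Perm.cycleOf_mem_cycleFactorsFinset_iff.2 hi,
      Perm.mem_support_cycleOf_iff.2 ⟨Perm.SameCycle.refl _ _, hi⟩⟩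

/-- The sign is `(-1)` to the size of the support plus the number of cycles. The minus signs of the
entries cancel the first part and leave one per cycle. -/
theorem permWeight_eq_prod_cycles {α R : Type*} [Fintype α] [DecidableEq α] [CommRing R]
    (N : α → Matrix α α R) (h : α → α) (σ : Perm α) :
    permWeight N h σ =
      ∏ c ∈ σ.cycleFactorsFinset, -∏ i ∈ c.support, N i (h i) (h (σ i)) := by
  have hd : (σ.cycleFactorsFinset : Set (Perm α)).PairwiseDisjoint Perm.support :=
    fun c hc d hd hcd =>
      (Perm.cycleFactorsFinset_pairwise_disjoint σ hc hd hcd).disjoint_support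
  have hp : ∏ i ∈ σ.support, N i (h i) (h (σ i)) =
      ∏ c ∈ σ.cycleFactorsFinset, ∏ i ∈ c.support, N i (h i) (h (σ i)) := by
    rw [← Finset.prod_biUnion hd, support_eq_biUnion_cycleFactorsFinset]
  have hc : σ.cycleType.card = σ.cycleFactorsFinset.card := by
    rw [Perm.cycleType_def, Multiset.card_map, Finset.card_val]
  rw [permWeight, Finset.prod_neg, Finset.prod_neg, hp, Perm.sign_of_cycleType,
    Perm.sum_cycleType, hc]
  push_cast
  have h1 : (-1 : R) ^ σ.support.card * (-1) ^ σ.support.card = 1 := by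
    rw [← mul_pow]
    simp
  rw [pow_add]
  linear_combination ((-1) ^ σ.cycleFactorsFinset.card *
    ∏ c ∈ σ.cycleFactorsFinset, ∏ i ∈ c.support, N i (h i) (h (σ i))) * h1

/-- The supports of the cycles are disjoint and stable under `σ`, so the values of `h` on different
cycles are summed independently. -/
theorem sum_mapsOn_permWeight {α R : Type*} [Fintype α] [DecidableEq α] [CommRing R]
    (N : α → Matrix α α R) (σ : Perm α) :
    ∑ h ∈ mapsOn σ.support, permWeight N h σ =
      ∏ c ∈ σ.cycleFactorsFinset,
        -∑ h ∈ mapsOn c.support, ∏ i ∈ c.support, N i (h i) (h (σ i)) := by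
  simp only [permWeight_eq_prod_cycles, ← Finset.sum_neg_distrib]
  rw [← sum_mapsOn_biUnion, support_eq_biUnion_cycleFactorsFinset]
  · exact fun c hc d hd hcd =>
      (Perm.cycleFactorsFinset_pairwise_disjoint σ hc hd hcd).disjoint_support
  · intro c hc h h' hh
    congr 1
    refine Finset.prod_congr rfl fun i hi => ?_
    rw [hh i hi, hh (σ i)]
    rw [← (Perm.mem_cycleFactorsFinset_iff.1 hc).2 i hi]
    exact Perm.apply_mem_support.2 hi

/-- The elements of the cycle of `σ` through `i` are `i, σ i, …, σ^(k-1) i`. -/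
theorem support_eq_image_iterate {α : Type*} [Fintype α] [DecidableEq α] {σ c : Perm α}
    (hc : c ∈ σ.cycleFactorsFinset) {i : α} (hi : i ∈ c.support) :
    c.support = (Finset.range (Function.minimalPeriod σ i)).image fun m => σ^[m] i := by
  have h1 := Perm.cycle_is_cycleOf hi hc
  have hper : 0 < Function.minimalPeriod σ i :=
    Function.minimalPeriod_pos_of_mem_periodicPts (σ.injective.mem_periodicPts i)
  have hσ : i ∈ σ.support := Perm.mem_cycleFactorsFinset_support_le hc hi
  ext j
  rw [h1, Perm.mem_support_cycleOf_iff, Finset.mem_image]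
  constructor
  · rintro ⟨hs, -⟩
    obtain ⟨k, -, hk⟩ := hs.exists_pow_eq'
    refine ⟨k % Function.minimalPeriod σ i, Finset.mem_range.2 (Nat.mod_lt _ hper), ?_⟩
    rw [Function.iterate_mod_minimalPeriod_eq, Perm.iterate_eq_pow]
    exact hk
  · rintro ⟨m, -, rfl⟩
    refine ⟨⟨m, ?_⟩, hσ⟩
    simp [Perm.iterate_eq_pow]

theorem sum_mapsOn_cycle {α R : Type*} [Fintype α] [DecidableEq α] [CommRing R]
    (N : α → Matrix α α R) {σ c : Perm α} (hc : c ∈ σ.cycleFactorsFinset) {i : α}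
    (hi : i ∈ c.support) :
    ∑ h ∈ mapsOn c.support, ∏ j ∈ c.support, N j (h j) (h (σ j)) =
      (orbitProd N σ (Function.minimalPeriod σ i) i).trace := by
  have hper : 0 < Function.minimalPeriod σ i :=
    Function.minimalPeriod_pos_of_mem_periodicPts (σ.injective.mem_periodicPts i)
  obtain ⟨k, hk⟩ := Nat.exists_eq_succ_of_ne_zero hper.ne'
  rw [hk]
  refine sum_mapsOn_eq_trace N σ k i _ ?_ ?_ ?_
  · have := Function.iterate_injOn_Iio_minimalPeriod (f := σ) (x := i)
    rwa [hk] at this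
  · rw [support_eq_image_iterate hc hi, hk]
  · have := Function.iterate_minimalPeriod (f := σ) (x := i)
    rwa [hk] at this

/-! ### Holonomies as products of edge blocks -/

/-- The matrix of the inclusion of the block of the vertex `a`, transposed. -/
def blockProj {V : Type*} [DecidableEq V] (n : V → ℕ) (a : V) :
    Matrix (Fin (n a)) (BlockIndex n) ℂ :=
  Matrix.of fun k p => if p = ⟨a, k⟩ then 1 else 0

/-- The block matrix whose only non-zero block is the matrix `U e` of the edge `e`. -/
def edgeBlock {V : Type*} [Quiver V] [Fintype V] [DecidableEq V] (n : V → ℕ)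
    (U : ∀ {a b : V}, (a ⟶ b) → Matrix (Fin (n a)) (Fin (n b)) ℂ) {a : V}
    (e : Quiver.Star a) : Matrix (BlockIndex n) (BlockIndex n) ℂ :=
  (blockProj n a).transpose * U e.2 * blockProj n e.1

theorem blockProj_mul_transpose {V : Type*} [Fintype V] [DecidableEq V] (n : V → ℕ) (a : V) :
    blockProj n a * (blockProj n a).transpose = 1 := by
  ext k l
  simp [blockProj, Matrix.mul_apply, Matrix.one_apply, eq_comm]

theorem blockProj_mulVec {V : Type*} [Fintype V] [DecidableEq V] (n : V → ℕ) (a : V)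
    (f : BlockIndex n → ℂ) : (blockProj n a).mulVec f = fun k => f ⟨a, k⟩ := by
  funext k
  simp [blockProj, Matrix.mulVec, dotProduct]

theorem transpose_blockProj_mulVec {V : Type*} [DecidableEq V] (n : V → ℕ) (a : V)
    (f : Fin (n a) → ℂ) (k : Fin (n a)) :
    (blockProj n a).transpose.mulVec f ⟨a, k⟩ = f k := by
  simp [blockProj, Matrix.mulVec, dotProduct]

theorem edgeBlock_apply_eq_zero {V : Type*} [Quiver V] [Fintype V] [DecidableEq V] (n : V → ℕ)
    (U : ∀ {a b : V}, (a ⟶ b) → Matrix (Fin (n a)) (Fin (n b)) ℂ) {a : V}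
    (e : Quiver.Star a) {p q : BlockIndex n} (h : ¬(p.1 = a ∧ q.1 = e.1)) :
    edgeBlock n U e p q = 0 := by
  rw [not_and_or] at h
  simp only [edgeBlock, blockProj, Matrix.mul_apply, Matrix.transpose_apply, Matrix.of_apply]
  rcases h with h | h
  · have : ∀ k, p ≠ ⟨a, k⟩ := by
      rintro k rfl
      exact h rfl
    simp [this]
  · have : ∀ k, q ≠ ⟨e.1, k⟩ := by
      rintro k rfl
      exact h rfl
    simp [this]

/-- Multiplying by `blockProj` moves the columns to the common index set, where the cast of the
endpoint becomes invisible. -/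
theorem pathHol_cast_mul_blockProj {V : Type*} [Quiver V] [DecidableEq V] (n : V → ℕ)
    (U : ∀ {a b : V}, (a ⟶ b) → Matrix (Fin (n a)) (Fin (n b)) ℂ) {a b b' : V}
    (p : Quiver.Path a b) (h : b = b') :
    pathHol n U (p.cast rfl h) * blockProj n b' = pathHol n U p * blockProj n b := by
  subst h
  rfl

theorem edge_cast_mul_blockProj {V : Type*} [Quiver V] [DecidableEq V] (n : V → ℕ)
    (U : ∀ {a b : V}, (a ⟶ b) → Matrix (Fin (n a)) (Fin (n b)) ℂ) {a b b' : V}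
    (e : a ⟶ b) (h : b = b') :
    U (e.cast rfl h) * blockProj n b' = U e * blockProj n b := by
  subst h
  rfl

theorem blockProj_mul_edgeBlock {V : Type*} [Quiver V] [Fintype V] [DecidableEq V] (n : V → ℕ)
    (U : ∀ {a b : V}, (a ⟶ b) → Matrix (Fin (n a)) (Fin (n b)) ℂ) {a : V}
    (e : Quiver.Star a) : blockProj n a * edgeBlock n U e = U e.2 * blockProj n e.1 := by
  rw [edgeBlock, ← Matrix.mul_assoc, ← Matrix.mul_assoc, blockProj_mul_transpose, Matrix.one_mul]

theorem WellChained.pathHol_walk_mul_blockProj {V : Type*} [Quiver V] [Fintype V] [DecidableEq V]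
    {n : V → ℕ} (U : ∀ {a b : V}, (a ⟶ b) → Matrix (Fin (n a)) (Fin (n b)) ℂ)
    {ξ : EdgeStack n} {σ : Perm (BlockIndex n)} (h : WellChained ξ σ) (k : ℕ)
    (i : BlockIndex n) (hi : σ i ≠ i) :
    pathHol n U (h.walk k i hi) * blockProj n (σ^[k] i).1 =
      blockProj n i.1 * orbitProd (fun j => edgeBlock n U (ξ j)) σ k i := by
  induction k generalizing i with
  | zero => exact (Matrix.one_mul _).trans (Matrix.mul_one _).symm
  | succ k ih =>
    have h1 := ih (σ i) fun h' => hi (σ.injective h')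
    have hcomp : ∀ {a b c : V} (p : Quiver.Path a b) (q : Quiver.Path b c),
        pathHol n U (p.comp q) * blockProj n c = pathHol n U p * (pathHol n U q * blockProj n c) :=
      fun p q => by rw [pathHol_comp, Matrix.mul_assoc]
    refine (hcomp _ (h.walk k (σ i) fun h' => hi (σ.injective h'))).trans ?_
    refine (congrArg _ h1).trans ?_
    rw [← Matrix.mul_assoc, orbitProd, ← Matrix.mul_assoc, blockProj_mul_edgeBlock]
    congr 1
    simp only [Quiver.Hom.toPath, pathHol, Matrix.one_mul]
    exact edge_cast_mul_blockProj n U _ _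

/-- The projection intertwines the holonomy with the product of edge blocks. By cyclicity of the
trace the product acquires `Pᵀ P` on its left, which its first edge block absorbs; the period is
positive, so there is one. -/
theorem WellChained.trace_loop {V : Type*} [Quiver V] [Fintype V] [DecidableEq V]
    {n : V → ℕ} (U : ∀ {a b : V}, (a ⟶ b) → Matrix (Fin (n a)) (Fin (n b)) ℂ)
    {ξ : EdgeStack n} {σ : Perm (BlockIndex n)} (h : WellChained ξ σ)
    (i : BlockIndex n) (hi : σ i ≠ i) :
    (pathHol n U (h.loop i hi)).trace =
      (orbitProd (fun j => edgeBlock n U (ξ j)) σ (Function.minimalPeriod σ i) i).trace := by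
  have h1 : pathHol n U (h.loop i hi) * blockProj n i.1 =
      blockProj n i.1 *
        orbitProd (fun j => edgeBlock n U (ξ j)) σ (Function.minimalPeriod σ i) i :=
    (pathHol_cast_mul_blockProj n U _ _).trans (h.pathHol_walk_mul_blockProj U _ i hi)
  obtain ⟨k, hk⟩ := Nat.exists_eq_succ_of_ne_zero
    (Function.minimalPeriod_pos_of_mem_periodicPts (σ.injective.mem_periodicPts i)).ne'
  rw [← Matrix.mul_one (pathHol n U _), ← blockProj_mul_transpose, ← Matrix.mul_assoc, h1,
    Matrix.trace_mul_cycle, hk, orbitProd, ← Matrix.mul_assoc, Matrix.mul_assoc _ (blockProj n i.1),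
    blockProj_mul_edgeBlock, edgeBlock]
  simp only [Matrix.mul_assoc]

theorem WellChained.prod_traceHol {V : Type*} [Quiver V] [Fintype V] [DecidableEq V]
    {n : V → ℕ} (U : ∀ {a b : V}, (a ⟶ b) → Matrix (Fin (n a)) (Fin (n b)) ℂ)
    {ξ : EdgeStack n} {σ : Perm (BlockIndex n)} (h : WellChained ξ σ) :
    ∏ c : {c : Perm (BlockIndex n) // c ∈ σ.cycleFactorsFinset}, -h.traceHol U c =
      ∑ f ∈ mapsOn σ.support, permWeight (fun j => edgeBlock n U (ξ j)) f σ := by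
  rw [sum_mapsOn_permWeight]
  refine Eq.trans ?_ (Finset.prod_coe_sort _ _)
  refine Finset.prod_congr rfl fun c _ => ?_
  rw [sum_mapsOn_cycle _ c.2 (exists_base c).choose_spec,
    ← h.trace_loop U _ (apply_ne_of_mem c (exists_base c).choose_spec)]
  rfl

/-! ### Vanishing weights and counting of relabellings -/

theorem permWeight_eq_zero_of_fst_ne {V : Type*} [Quiver V] [Fintype V] [DecidableEq V]
    {n : V → ℕ} (U : ∀ {a b : V}, (a ⟶ b) → Matrix (Fin (n a)) (Fin (n b)) ℂ)
    (ξ : EdgeStack n) (σ : Perm (BlockIndex n)) (f : BlockIndex n → BlockIndex n)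
    {i : BlockIndex n} (hi : i ∈ σ.support) (hf : (f i).1 ≠ i.1) :
    permWeight (fun j => edgeBlock n U (ξ j)) f σ = 0 := by
  rw [permWeight, Finset.prod_eq_zero hi, mul_zero]
  rw [edgeBlock_apply_eq_zero, neg_zero]
  exact fun h => hf h.1

/-- At a bad index `i`, either `f (σ i)` lies in the block of `σ i` and the factor at `i` has its
column in the wrong block, or the factor at `σ i` has its row in the wrong block. -/
theorem permWeight_eq_zero_of_not_wellChained {V : Type*} [Quiver V] [Fintype V] [DecidableEq V]
    {n : V → ℕ} (U : ∀ {a b : V}, (a ⟶ b) → Matrix (Fin (n a)) (Fin (n b)) ℂ)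
    (ξ : EdgeStack n) (σ : Perm (BlockIndex n)) (f : BlockIndex n → BlockIndex n)
    (hσ : ¬WellChained ξ σ) :
    permWeight (fun j => edgeBlock n U (ξ j)) f σ = 0 := by
  simp only [WellChained, not_forall, not_or] at hσ
  obtain ⟨i, hi, ht⟩ := hσ
  by_cases hf : (f (σ i)).1 = (σ i).1
  · rw [permWeight, Finset.prod_eq_zero (Perm.mem_support.2 hi), mul_zero]
    rw [edgeBlock_apply_eq_zero, neg_zero]
    exact fun h => ht (h.2.symm.trans hf)
  · exact permWeight_eq_zero_of_fst_ne U ξ σ f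
      (Perm.apply_mem_support.2 (Perm.mem_support.2 hi)) hf

theorem edgeBlock_apply_self {V : Type*} [Quiver V] [Fintype V] [DecidableEq V]
    (no_loops : ∀ a : V, IsEmpty (a ⟶ a)) {n : V → ℕ}
    (U : ∀ {a b : V}, (a ⟶ b) → Matrix (Fin (n a)) (Fin (n b)) ℂ) {a : V} (e : Quiver.Star a)
    (p : BlockIndex n) : edgeBlock n U e p p = 0 := by
  refine edgeBlock_apply_eq_zero n U e ?_
  rintro ⟨h1, h2⟩
  obtain ⟨b, e⟩ := e
  have h3 : a = b := h1.symm.trans h2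
  subst h3
  exact (no_loops a).false e

/-- The number of block-preserving permutations that extend a block-preserving injection of `S`. -/
theorem card_sigmaCongrRight_eqOn {V : Type*} [Fintype V] [DecidableEq V] {n : V → ℕ}
    (S : Finset (BlockIndex n)) (f : BlockIndex n → BlockIndex n) (hinj : Set.InjOn f S)
    (hf : ∀ i ∈ S, (f i).1 = i.1) :
    (Finset.univ.filter fun g : ∀ a, Perm (Fin (n a)) =>
        ∀ i ∈ S, Equiv.sigmaCongrRight g i = f i).card =
      ∏ a, (n a - (S.filter fun i => i.1 = a).card).factorial := by
  have hφ : ∀ (a : V) (k : Fin (n a)), ∃ l : Fin (n a), (⟨a, k⟩ : BlockIndex n) ∈ S →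
      f ⟨a, k⟩ = ⟨a, l⟩ := by
    intro a k
    by_cases h : (⟨a, k⟩ : BlockIndex n) ∈ S
    · have h1 := hf _ h
      generalize f ⟨a, k⟩ = q at h1 ⊢
      obtain ⟨b, l⟩ := q
      obtain rfl : b = a := h1
      exact ⟨l, fun _ => rfl⟩
    · exact ⟨k, fun h' => absurd h' h⟩
  choose φ hφ using hφ
  let T : ∀ a, Finset (Fin (n a)) := fun a => Finset.univ.filter fun k => (⟨a, k⟩ : BlockIndex n) ∈ S
  have hT : ∀ a, (S.filter fun i => i.1 = a).card = (T a).card := by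
    intro a
    symm
    refine Finset.card_bij (fun k _ => ⟨a, k⟩) ?_ ?_ ?_
    · intro k hk
      simpa [T] using hk
    · intro k _ l _ h
      simpa using h
    · rintro ⟨b, k⟩ hb
      rw [Finset.mem_filter] at hb
      obtain ⟨hb, h⟩ := hb
      obtain rfl : b = a := h
      exact ⟨k, by simpa [T] using hb, rfl⟩
  -- The condition splits into independent ones, one per vertex, so the count is a product.
  have hset : (Finset.univ.filter fun g : ∀ a, Perm (Fin (n a)) =>
        ∀ i ∈ S, Equiv.sigmaCongrRight g i = f i) =
      Fintype.piFinset fun a => Finset.univ.filter fun τ : Perm (Fin (n a)) =>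
        ∀ k ∈ T a, τ k = φ a k := by
    ext g
    simp only [Finset.mem_filter, Finset.mem_univ, true_and, Fintype.mem_piFinset, T]
    constructor
    · intro h a k hk
      have h1 := (h _ hk).trans (hφ a k hk)
      simpa using h1
    · rintro h ⟨a, k⟩ hk
      rw [hφ a k hk, ← h a k hk]
      rfl
  rw [hset, Fintype.card_piFinset]
  refine Finset.prod_congr rfl fun a _ => ?_
  have hcard := card_perm_eqOn (T a) (φ a) ?_
  · rw [hT]
    rw [Fintype.card_fin] at hcard
    convert hcard
  intro k hk l hl h
  have hk' : (⟨a, k⟩ : BlockIndex n) ∈ S := by simpa [T] using hk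
  have hl' : (⟨a, l⟩ : BlockIndex n) ∈ S := by simpa [T] using hl
  have := hinj hk' hl' (by rw [hφ a k hk', hφ a l hl', h])
  simpa using this

theorem permWeight_congr {α R : Type*} [Fintype α] [DecidableEq α] [CommRing R]
    (N : α → Matrix α α R) (σ : Perm α) {f f' : α → α} (h : ∀ i ∈ σ.support, f i = f' i) :
    permWeight N f σ = permWeight N f' σ := by
  rw [permWeight, permWeight]
  congr 1
  refine Finset.prod_congr rfl fun i hi => ?_
  rw [h i hi, h _ (Perm.apply_mem_support.2 hi)]

/-- Relabellings are grouped by their restriction to the support, which alone determines the weight.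
-/
theorem sum_sigmaCongrRight_permWeight {V R : Type*} [Fintype V] [DecidableEq V] [CommRing R]
    {n : V → ℕ} (N : BlockIndex n → Matrix (BlockIndex n) (BlockIndex n) R)
    (σ : Perm (BlockIndex n)) :
    ∑ g : ∀ a, Perm (Fin (n a)), permWeight N (Equiv.sigmaCongrRight g) σ =
      ∑ f ∈ mapsOn σ.support, ((Finset.univ.filter fun g : ∀ a, Perm (Fin (n a)) =>
        ∀ i ∈ σ.support, Equiv.sigmaCongrRight g i = f i).card : R) * permWeight N f σ := by
  rw [← Finset.sum_fiberwise_of_maps_to (t := mapsOn σ.support)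
    (g := fun g : ∀ a, Perm (Fin (n a)) => σ.support.piecewise (Equiv.sigmaCongrRight g) id)]
  · refine Finset.sum_congr rfl fun f hf => ?_
    rw [mem_mapsOn] at hf
    have hiff : ∀ g : ∀ a, Perm (Fin (n a)),
        σ.support.piecewise (Equiv.sigmaCongrRight g) id = f ↔
          ∀ i ∈ σ.support, Equiv.sigmaCongrRight g i = f i := by
      intro g
      constructor
      · rintro rfl i hi
        rw [Finset.piecewise_eq_of_mem _ _ _ hi]
      · intro h
        funext i
        by_cases hi : i ∈ σ.support
        · rw [Finset.piecewise_eq_of_mem _ _ _ hi, h i hi]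
        · rw [Finset.piecewise_eq_of_notMem _ _ _ hi, hf i hi, id]
    simp only [hiff]
    rw [Finset.sum_congr rfl fun g hg => permWeight_congr N σ (Finset.mem_filter.1 hg).2,
      Finset.sum_const, nsmul_eq_mul]
  · intro g _
    rw [mem_mapsOn]
    intro i hi
    rw [Finset.piecewise_eq_of_notMem _ _ _ hi, id]

/-! ### Averaging for a fixed edge stack -/

/-- For a fixed edge stack, averaging over the relabellings of the blocks. -/
theorem sum_det_relabel {V : Type*} [Quiver V] [Fintype V] [DecidableEq V]
    (no_loops : ∀ a : V, IsEmpty (a ⟶ a)) {n : V → ℕ}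
    (U : ∀ {a b : V}, (a ⟶ b) → Matrix (Fin (n a)) (Fin (n b)) ℂ) (ξ : EdgeStack n) :
    ∑ g : ∀ a, Perm (Fin (n a)), (Matrix.of fun i j =>
        (1 : Matrix (BlockIndex n) (BlockIndex n) ℂ) i j -
          edgeBlock n U (ξ i) (Equiv.sigmaCongrRight g i) (Equiv.sigmaCongrRight g j)).det =
      ∑ σ : {σ : Perm (BlockIndex n) // WellChained ξ σ},
        (∏ a : V, ((n a - visits a σ.1).factorial : ℂ)) *
          ∏ c : {c : Perm (BlockIndex n) // c ∈ σ.1.cycleFactorsFinset}, -(σ.2.traceHol U c) := by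
  set N : BlockIndex n → Matrix (BlockIndex n) (BlockIndex n) ℂ := fun i => edgeBlock n U (ξ i)
    with hN
  have hdiag : ∀ (f : BlockIndex n → BlockIndex n) i, N i (f i) (f i) = 0 := fun f i =>
    edgeBlock_apply_self no_loops U (ξ i) (f i)
  have hR : ∑ σ : {σ : Perm (BlockIndex n) // WellChained ξ σ},
        (∏ a : V, ((n a - visits a σ.1).factorial : ℂ)) *
          ∏ c : {c : Perm (BlockIndex n) // c ∈ σ.1.cycleFactorsFinset}, -(σ.2.traceHol U c) =
      ∑ σ : Perm (BlockIndex n), ∑ f ∈ mapsOn σ.support,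
        (∏ a : V, ((n a - (σ.support.filter fun i => i.1 = a).card).factorial : ℂ)) *
          permWeight N f σ := by
    have h1 : ∀ σ : {σ : Perm (BlockIndex n) // WellChained ξ σ},
        (∏ a : V, ((n a - visits a σ.1).factorial : ℂ)) *
          ∏ c : {c : Perm (BlockIndex n) // c ∈ σ.1.cycleFactorsFinset}, -(σ.2.traceHol U c) =
        ∑ f ∈ mapsOn σ.1.support,
        (∏ a : V, ((n a - (σ.1.support.filter fun i => i.1 = a).card).factorial : ℂ)) *
          permWeight N f σ.1 := by
      intro σ
      rw [σ.2.prod_traceHol, Finset.mul_sum]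
      simp only [visits_eq, hN]
    rw [Finset.sum_congr rfl fun σ _ => h1 σ,
      ← Finset.sum_subtype (Finset.univ.filter fun σ => WellChained ξ σ) (by simp)
        fun σ : Perm (BlockIndex n) => ∑ f ∈ mapsOn σ.support,
        (∏ a : V, ((n a - (σ.support.filter fun i => i.1 = a).card).factorial : ℂ)) *
          permWeight N f σ]
    refine Finset.sum_subset (Finset.filter_subset _ _) fun σ _ hσ => ?_
    refine Finset.sum_eq_zero fun f _ => ?_
    rw [permWeight_eq_zero_of_not_wellChained U ξ σ f (by simpa using hσ), mul_zero]
  rw [hR, Finset.sum_congr rfl fun g _ =>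
    det_one_sub_eq_sum_permWeight N (Equiv.sigmaCongrRight g) (hdiag _), Finset.sum_comm]
  simp only [sum_sigmaCongrRight_permWeight]
  -- On both sides the coefficient of a weight depends only on `f` and the support of `σ`. Grouping
  -- by support isolates the inner sum that cancels for non-injective `f`.
  rw [← Finset.sum_fiberwise (g := Perm.support), ← Finset.sum_fiberwise (g := Perm.support)]
  refine Finset.sum_congr rfl fun S _ => ?_
  have hS : ∀ F : Finset (BlockIndex n) → (BlockIndex n → BlockIndex n) → ℂ,
      ∑ σ : Perm (BlockIndex n) with σ.support = S,
        ∑ f ∈ mapsOn σ.support, F σ.support f * permWeight N f σ =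
      ∑ f ∈ mapsOn S, F S f * ∑ σ : Perm (BlockIndex n) with σ.support = S, permWeight N f σ := by
    intro F
    simp only [Finset.mul_sum]
    rw [Finset.sum_comm]
    refine Finset.sum_congr rfl fun σ hσ => ?_
    rw [(Finset.mem_filter.1 hσ).2]
  rw [hS fun S f => ((Finset.univ.filter fun g : ∀ a, Perm (Fin (n a)) =>
        ∀ i ∈ S, Equiv.sigmaCongrRight g i = f i).card : ℂ),
    hS fun S _ => ∏ a : V, ((n a - (S.filter fun i => i.1 = a).card).factorial : ℂ)]
  refine Finset.sum_congr rfl fun f _ => ?_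
  by_cases hinj : Set.InjOn f S
  · by_cases hf : ∀ i ∈ S, (f i).1 = i.1
    · rw [card_sigmaCongrRight_eqOn S f hinj hf]
      push_cast
      rfl
    · push Not at hf
      obtain ⟨i, hi, hf⟩ := hf
      rw [Finset.sum_eq_zero, mul_zero, mul_zero]
      intro σ hσ
      rw [Finset.mem_filter] at hσ
      exact permWeight_eq_zero_of_fst_ne U ξ σ f (hσ.2 ▸ hi) hf
  · simp only [Set.InjOn, not_forall] at hinj
    obtain ⟨i, hi, j, hj, hij, hne⟩ := hinj
    rw [sum_permWeight_eq_zero N f (hdiag f) S hi hj hne hij, mul_zero, mul_zero]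

/-! ### Expansion of the determinant over edge stacks -/

/-- The matrix of the twisted Laplacian. -/
def laplacianMatrix {V : Type*} [Quiver V] [Fintype V] [DecidableEq V]
    [∀ a b : V, Fintype (a ⟶ b)] (n : V → ℕ) (x : ∀ {a b : V}, (a ⟶ b) → ℂ)
    (U : ∀ {a b : V}, (a ⟶ b) → Matrix (Fin (n a)) (Fin (n b)) ℂ) :
    Matrix (BlockIndex n) (BlockIndex n) ℂ :=
  Matrix.of fun i j => ∑ e : Quiver.Star i.1, x e.2 *
    ((1 : Matrix (BlockIndex n) (BlockIndex n) ℂ) i j - edgeBlock n U e i j)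

theorem det_quiverLaplacian {V : Type*} [Quiver V] [Fintype V] [DecidableEq V]
    [∀ a b : V, Fintype (a ⟶ b)] (n : V → ℕ) (x : ∀ {a b : V}, (a ⟶ b) → ℂ)
    (U : ∀ {a b : V}, (a ⟶ b) → Matrix (Fin (n a)) (Fin (n b)) ℂ) :
    LinearMap.det (quiverLaplacian n x U) = (laplacianMatrix n x U).det := by
  rw [← LinearMap.det_toLin']
  rw [← LinearMap.det_conj (Matrix.toLin' (laplacianMatrix n x U))
    (LinearEquiv.piCurry ℂ fun (a : V) (_ : Fin (n a)) => ℂ)]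
  congr 1
  refine LinearMap.ext fun f => funext fun v => funext fun k => ?_
  set F : BlockIndex n → ℂ :=
    (LinearEquiv.piCurry ℂ fun (a : V) (_ : Fin (n a)) => ℂ).symm f with hF
  have hfF : ∀ a, f a = fun k => F ⟨a, k⟩ := fun a => rfl
  change _ = (laplacianMatrix n x U).mulVec F ⟨v, k⟩
  have h1 : (laplacianMatrix n x U).mulVec F ⟨v, k⟩ =
      ∑ e : Quiver.Star v, x e.2 * (F ⟨v, k⟩ - (edgeBlock n U e).mulVec F ⟨v, k⟩) := by
    simp only [Matrix.mulVec, dotProduct, laplacianMatrix, Matrix.of_apply, Finset.sum_mul]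
    rw [Finset.sum_comm]
    refine Finset.sum_congr rfl fun e _ => ?_
    simp only [mul_assoc, ← Finset.mul_sum, sub_mul, Finset.sum_sub_distrib]
    simp [Matrix.one_apply]
  rw [h1]
  simp only [quiverLaplacian, LinearMap.coe_mk, AddHom.coe_mk, Finset.sum_apply, Pi.smul_apply,
    Pi.sub_apply, smul_eq_mul]
  refine Finset.sum_congr rfl fun e _ => ?_
  rw [edgeBlock, ← Matrix.mulVec_mulVec, ← Matrix.mulVec_mulVec, transpose_blockProj_mulVec,
    blockProj_mulVec, ← hfF]
  rfl

/-- A relabelling preserves blocks, so row `i` is still a sum over the edges leaving the block of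
`i`. Hence the same stacks index the expansion for every `g`. -/
theorem det_laplacianMatrix_relabel {V : Type*} [Quiver V] [Fintype V] [DecidableEq V]
    [∀ a b : V, Fintype (a ⟶ b)] (n : V → ℕ) (x : ∀ {a b : V}, (a ⟶ b) → ℂ)
    (U : ∀ {a b : V}, (a ⟶ b) → Matrix (Fin (n a)) (Fin (n b)) ℂ)
    (g : ∀ a, Perm (Fin (n a))) :
    (laplacianMatrix n x U).det = ∑ ξ : EdgeStack n, (∏ i, x (ξ i).2) *
      (Matrix.of fun i j => (1 : Matrix (BlockIndex n) (BlockIndex n) ℂ) i j -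
        edgeBlock n U (ξ i) (Equiv.sigmaCongrRight g i) (Equiv.sigmaCongrRight g j)).det := by
  rw [← Matrix.det_submatrix_equiv_self (Equiv.sigmaCongrRight g)]
  have h1 : (laplacianMatrix n x U).submatrix (Equiv.sigmaCongrRight g)
      (Equiv.sigmaCongrRight g) = Matrix.of fun i => ∑ e : Quiver.Star i.1, x e.2 • fun j =>
        ((1 : Matrix (BlockIndex n) (BlockIndex n) ℂ) i j -
          edgeBlock n U e (Equiv.sigmaCongrRight g i) (Equiv.sigmaCongrRight g j)) := by
    ext i j
    simp only [Matrix.submatrix_apply, laplacianMatrix, Matrix.of_apply, Finset.sum_apply,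
      Pi.smul_apply, smul_eq_mul, Matrix.one_apply, EmbeddingLike.apply_eq_iff_eq]
    rfl
  rw [h1]
  refine ((Matrix.detRowAlternating (R := ℂ)).toMultilinearMap.map_sum
    fun (i : BlockIndex n) (e : Quiver.Star i.1) => x e.2 • fun j =>
        ((1 : Matrix (BlockIndex n) (BlockIndex n) ℂ) i j -
          edgeBlock n U e (Equiv.sigmaCongrRight g i) (Equiv.sigmaCongrRight g j))).trans ?_
  refine Finset.sum_congr rfl fun ξ _ => ?_
  exact (Matrix.detRowAlternating (R := ℂ)).toMultilinearMap.map_smul_univ _ _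

theorem theorem6p1 {V : Type*} [Quiver V] [Fintype V] [DecidableEq V]
    [∀ a b : V, Fintype (a ⟶ b)] (no_loops : ∀ a : V, IsEmpty (a ⟶ a))
    (n : V → ℕ) (hn : ∀ a, 1 ≤ n a) (x : ∀ {a b : V}, (a ⟶ b) → ℂ)
    (U : ∀ {a b : V}, (a ⟶ b) → Matrix (Fin (n a)) (Fin (n b)) ℂ) :
    LinearMap.det (quiverLaplacian n x U) =
      1 / (∏ a : V, ((n a).factorial : ℂ)) *
        ∑ ξ : EdgeStack n, (∏ i, x (ξ i).2) *
          ∑ σ : {σ : Equiv.Perm (BlockIndex n) // WellChained ξ σ},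
            (∏ a : V, ((n a - visits a σ.1).factorial : ℂ)) *
              ∏ c : {c : Equiv.Perm (BlockIndex n) // c ∈ σ.1.cycleFactorsFinset},
                -(σ.2.traceHol U c) := by
  have hG : (Fintype.card (∀ a, Perm (Fin (n a))) : ℂ) = ∏ a : V, ((n a).factorial : ℂ) := by
    simp [Fintype.card_pi, Fintype.card_perm]
  have hG0 : (∏ a : V, ((n a).factorial : ℂ)) ≠ 0 :=
    Finset.prod_ne_zero_iff.2 fun a _ => Nat.cast_ne_zero.2 (n a).factorial_ne_zero
  -- The factor `∏ n_a!` is read as the number of relabellings, so that each `g` accounts for one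
  -- copy of the determinant.
  rw [eq_comm, one_div, inv_mul_eq_iff_eq_mul₀ hG0, ← hG, det_quiverLaplacian]
  simp only [← sum_det_relabel no_loops U, Finset.mul_sum]
  rw [Finset.sum_comm, Finset.sum_congr rfl fun g _ => (det_laplacianMatrix_relabel n x U g).symm,
    Finset.sum_const, Finset.card_univ, nsmul_eq_mul]
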